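/- Let $X$ be a real random variable with distribution function $F$ and density $f$. Assume Rényi's condition, i.e. that $\lfloor X\rfloor$ has finite entropy, $$\sum_{k\in\mathbb Z}\mathbf P\{\lfloor X\rfloor=k\}\log_2\frac1{\mathbf P\{\lfloor X\rfloor=k\}}<\infty ,$$ and assume that $\mathcal E(f)=\int f\log_2(1/f)>-\infty$. Let $U_1,U_2,\dots$ be independent fair coins (Bernoulli$(1/2)$ bits), and for $t\ge 0$ put $U_{(t)}=\sum_{j=1}^{t}U_j2^{-j}$ and $U_{(t)}^{+}=U_{(t)}+2^{-t}$. Let $F^{-1}(u)=\inf\{x:F(x)\ge u\}$ for $0<u\le1$ (with $\inf\emptyset=+\infty$) and $F^{-1}(0)=\inf\{x:F(x)>0\}\in[-\infty,\infty)$. For $\epsilon>0$ let $$T=T_\epsilon=\min\{t\ge 0: F^{-1}(U_{(t)}^{+})-F^{-1}(U_{(t)})\le 2\epsilon\}$$ ($T=\infty$ if there is no such $t$) be the number of coins used by the inversion method with accuracy $\epsilon$. Then $\mathcal E(f)$ is finite, and as $\epsilon\downarrow0$, $$\mathbf E(T)\le\log_2\Big(\frac1\epsilon\Big)+\mathcal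 E(f)+2+o(1).$$ -/

import Mathlib

open MeasureTheory ProbabilityTheory Filter Topology
open scoped ENNReal

noncomputable section

/-- The entropy `H(⌊X⌋) = ∑ₖ pₖ log₂ (1 / pₖ)`, `pₖ = P(⌊X⌋ = k)`, `k ∈ ℤ`, as an element of
`[0, ∞]`. All terms are nonnegative, and a term with `pₖ = 0` is `0`. -/
def floorEntropy {Ω : Type*} [MeasurableSpace Ω] (P : Measure Ω) (X : Ω → ℝ) : ℝ≥0∞ :=
  ∑' k : ℤ, ENNReal.ofReal
    (P.real {ω | ⌊X ω⌋ = k} * Real.logb 2 (1 / P.real {ω | ⌊X ω⌋ = k}))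

/-- Rényi's condition: `⌊X⌋` has finite entropy. -/
def RenyiCondition {Ω : Type*} [MeasurableSpace Ω] (P : Measure Ω) (X : Ω → ℝ) : Prop :=
  floorEntropy P X < ∞

/-- `f` is a density of `X` (with respect to Lebesgue measure). -/
structure IsDensityOf {Ω : Type*} [MeasurableSpace Ω] (P : Measure Ω) (X : Ω → ℝ)
    (f : ℝ → ℝ) : Prop where
  measurable : Measurable f
  nonneg : ∀ x, 0 ≤ f x
  map_eq : P.map X = (volume : Measure ℝ).withDensity (fun x => ENNReal.ofReal (f x))

/-- The differential entropy `∫ f log₂ (1 / f)` as an extended real number: the integral of the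
positive part minus the integral of the negative part. (If both are infinite, so that the
integral is not defined, the value is `⊥`, by the convention `⊤ - ⊤ = ⊥` in `EReal`.) -/
def differentialEntropy (f : ℝ → ℝ) : EReal :=
  ((∫⁻ x, ENNReal.ofReal (f x * Real.logb 2 (1 / f x)) : ℝ≥0∞) : EReal)
    - ((∫⁻ x, ENNReal.ofReal (-(f x * Real.logb 2 (1 / f x))) : ℝ≥0∞) : EReal)

/-- The inverse `F⁻¹ : [0, 1] → [-∞, ∞]` of a distribution function `F`. For `0 < u ≤ 1` this is
`inf {x | u ≤ F x}` (with `inf ∅ = ∞`, which can only occur at `u = 1`); at `u = 0` it is the left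
end `inf {x | 0 < F x}` of the support, equal to `-∞` if the support is unbounded below. -/
def inverseCdf (F : ℝ → ℝ) (u : ℝ) : EReal :=
  sInf ((fun x : ℝ => (x : EReal)) '' {x : ℝ | 0 < F x ∧ u ≤ F x})

/-- The truncation `U₍ₜ₎ = 0.U₁ ⋯ Uₜ` in base 2; the coin `b j` is the bit `U_{j+1}`. -/
def truncatedUniform (b : ℕ → Bool) (t : ℕ) : ℝ :=
  ∑ j ∈ Finset.range t, (if b j then (1 : ℝ) else 0) / 2 ^ (j + 1)

/-- The inversion method for `F` with accuracy `ε` may stop after having seen `t` coins: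
`F⁻¹(U₍ₜ₎⁺) - F⁻¹(U₍ₜ₎) ≤ 2 ε`, where `U₍ₜ₎⁺ = U₍ₜ₎ + 2⁻ᵗ`. -/
def InversionStops (F : ℝ → ℝ) (ε : ℝ) (b : ℕ → Bool) (t : ℕ) : Prop :=
  inverseCdf F (truncatedUniform b t + 1 / 2 ^ t) - inverseCdf F (truncatedUniform b t)
    ≤ ((2 * ε : ℝ) : EReal)

/-- The number of coins `T = min {t ≥ 0 | F⁻¹(U₍ₜ₎⁺) - F⁻¹(U₍ₜ₎) ≤ 2 ε}` used by the inversion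
method on the sequence of coins `b`; it is `∞` if the method never stops on `b`. -/
def inversionCoins (F : ℝ → ℝ) (ε : ℝ) (b : ℕ → Bool) : ℕ∞ :=
  ⨅ t ∈ {t : ℕ | InversionStops F ε b t}, (t : ℕ∞)

/-- `B 0, B 1, …` are independent fair coins under `Q`. -/
structure IsFairCoins {Ω : Type*} [MeasurableSpace Ω] (Q : Measure Ω)
    (B : ℕ → Ω → Bool) : Prop where
  measurable : ∀ j, Measurable (B j)
  indep : iIndepFun B Q
  fair : ∀ j, Q {ω | B j ω = true} = 1 / 2

end

/-! Cut the line into cells of length `1 / n ≤ 2 * ε` with probabilities `p k`; under `F` they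
become intervals partitioning `(0, 1)`. The method stops as soon as the current dyadic interval lies
inside one of these (strictly to the right of its left end), so `E(T)` is at most the sum over `t`
of the total length of the bad dyadic intervals of level `t`, those not so contained. At most two
bad intervals meet a given cell, so that total is at most `∑ k, min (p k) (2 * 2⁻ᵗ)`
(`card_mul_le_tsum_min`). Summing over `t` first gives at most `p k * (log₂ (1 / p k) + 3)` per cell
(`tsum_min_le`), hence `E(T) ≤ H n + 3` with `H n` the entropy of the partition.

It remains to show `H n ≤ log₂ n + ℰ(f) + o(1)`. Let `g n` be the histogram density of mesh `1 / n`.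
Then `H n = log₂ n + H 1 - D(g n ‖ g 1)` and `ℰ(f) = H 1 - D(f ‖ g 1)`. Since `g n → f` almost
everywhere and the integrand of `D` is nonnegative, Fatou's lemma gives `D(f ‖ g 1) ≤ liminf D(g n ‖
g 1)`. Finally `n = ⌈1 / (2 * ε)⌉` has `log₂ n ≤ log₂ (1 / ε) - 1 + o(1)`, and `3 - 1 = 2`. -/

/-! ### Dyadic prefixes and the stopping rule -/

/-- The integer `2 ^ t * U₍ₜ₎` whose binary digits are the first `t` coins. -/
def prefixNat (b : ℕ → Bool) : ℕ → ℕ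
  | 0 => 0
  | t + 1 => 2 * prefixNat b t + (b t).toNat

lemma prefixNat_lt (b : ℕ → Bool) (t : ℕ) : prefixNat b t < 2 ^ t := by
  induction t with
  | zero => simp [prefixNat]
  | succ t ih =>
    have := Bool.toNat_le (b t)
    rw [prefixNat, pow_succ]
    omega

lemma eq_of_prefixNat_eq {b c : ℕ → Bool} {t : ℕ} (h : prefixNat b t = prefixNat c t) :
    ∀ j < t, b j = c j := by
  induction t with
  | zero => simp
  | succ t ih =>
    have hb := Bool.toNat_le (b t)
    have hc := Bool.toNat_le (c t)
    simp only [prefixNat] at h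
    intro j hj
    rcases Nat.lt_succ_iff_lt_or_eq.mp hj with hj | rfl
    · exact ih (by omega) j hj
    · have : (b j).toNat = (c j).toNat := by omega
      cases hbj : b j <;> cases hcj : c j <;> simp_all

lemma truncatedUniform_eq (b : ℕ → Bool) (t : ℕ) :
    truncatedUniform b t = (prefixNat b t : ℝ) / 2 ^ t := by
  induction t with
  | zero => simp [truncatedUniform, prefixNat]
  | succ t ih =>
    have h : truncatedUniform b (t + 1)
        = truncatedUniform b t + (if b t then (1 : ℝ) else 0) / 2 ^ (t + 1) :=
      Finset.sum_range_succ _ _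
    rw [h, ih, prefixNat, pow_succ]
    cases b t <;> simp <;> field_simp

/-- The inequality at `x` must be strict: for `u > 0`, `F x = u` would only give `F⁻¹(u) ≤ x`,
whereas a lower bound on `F⁻¹(u)` is needed. -/
lemma inversionStops_of_subset {F : ℝ → ℝ} (hF : Monotone F) {ε x y : ℝ} {b : ℕ → Bool} {t : ℕ}
    (hxy : y - x ≤ 2 * ε) (hx : F x < (prefixNat b t : ℝ) / 2 ^ t)
    (hy : ((prefixNat b t : ℝ) + 1) / 2 ^ t ≤ F y) : InversionStops F ε b t := by
  have hu : truncatedUniform b t + 1 / 2 ^ t = ((prefixNat b t : ℝ) + 1) / 2 ^ t := by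
    rw [truncatedUniform_eq]; ring
  rw [InversionStops, hu, truncatedUniform_eq]
  have h1 : inverseCdf F (((prefixNat b t : ℝ) + 1) / 2 ^ t) ≤ (y : EReal) :=
    sInf_le ⟨y, ⟨lt_of_lt_of_le (by positivity) hy, hy⟩, rfl⟩
  have h2 : (x : EReal) ≤ inverseCdf F ((prefixNat b t : ℝ) / 2 ^ t) := by
    refine le_sInf ?_
    rintro _ ⟨z, ⟨-, hz⟩, rfl⟩
    have : x ≤ z := by
      by_contra! hlt
      exact absurd (hF hlt.le) (by linarith)
    exact EReal.coe_le_coe_iff.mpr this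
  calc _ ≤ (y : EReal) - (x : EReal) := EReal.sub_le_sub h1 h2
    _ ≤ _ := by rw [← EReal.coe_sub]; exact_mod_cast hxy

/-! ### Counting bad dyadic intervals -/

lemma exists_mem_Ioc_of_tendsto {α : ℤ → ℝ} (hbot : Tendsto α atBot (𝓝 0))
    (htop : Tendsto α atTop (𝓝 1)) {x : ℝ} (hx0 : 0 < x) (hx1 : x < 1) :
    ∃ k, x ∈ Set.Ioc (α k) (α (k + 1)) := by
  have hne : ∃ k, α k < x := (hbot.eventually (gt_mem_nhds hx0)).exists
  obtain ⟨K, hK⟩ := eventually_atTop.mp (htop.eventually (lt_mem_nhds hx1))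
  obtain ⟨k, hk, hmax⟩ := Int.exists_greatest_of_bdd (P := fun k => α k < x)
    ⟨K, fun z hz => by
      by_contra! hlt
      exact lt_asymm hz (hK z hlt.le)⟩ hne
  refine ⟨k, hk, ?_⟩
  by_contra! hlt
  have := hmax (k + 1) hlt
  omega

/-- The number of dyadic intervals of level `t` not contained in a single interval
`(α k, α (k + 1)]`, in terms of the lengths of these intervals. -/
lemma card_mul_le_tsum_min {α : ℤ → ℝ} (hbot : Tendsto α atBot (𝓝 0))
    (htop : Tendsto α atTop (𝓝 1)) (t : ℕ) (s : Finset ℕ) (hs : ∀ m ∈ s, m < 2 ^ t)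
    (hbad : ∀ m ∈ s, ∀ k, α k < (m : ℝ) / 2 ^ t → α (k + 1) < ((m : ℝ) + 1) / 2 ^ t) :
    (s.card : ℝ≥0∞) * 2⁻¹ ^ t
      ≤ ∑' k, min (ENNReal.ofReal (α (k + 1) - α k)) (2 * 2⁻¹ ^ t) := by
  have h2 : (0 : ℝ) < 2 ^ t := by positivity
  set I : ℕ → Set ℝ := fun m => Set.Ioo ((m : ℝ) / 2 ^ t) (((m : ℝ) + 1) / 2 ^ t) with hI
  set C : ℤ → Set ℝ := fun k => Set.Ioc (α k) (α (k + 1)) with hC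
  have hvol : ∀ m, volume (I m) = 2⁻¹ ^ t := by
    intro m
    rw [hI, Real.volume_Ioo, ← sub_div, add_sub_cancel_left, one_div,
      ENNReal.ofReal_inv_of_pos h2, ENNReal.ofReal_pow (by norm_num), ENNReal.inv_pow]
    simp
  have hdisj : Pairwise (Function.onFun Disjoint I) := by
    intro m m' hmm
    rw [Function.onFun, Set.disjoint_left]
    rintro x ⟨h1, h2'⟩ ⟨h3, h4⟩
    rw [div_lt_iff₀ h2] at h1 h3
    rw [lt_div_iff₀ h2] at h2' h4
    have a : m < m' + 1 := by exact_mod_cast h1.trans h4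
    have b : m' < m + 1 := by exact_mod_cast h3.trans h2'
    omega
  have hcover : ∀ m ∈ s, volume (I m) ≤ ∑' k, volume (I m ∩ C k) := by
    intro m hm
    refine le_trans (measure_mono ?_) (measure_iUnion_le _)
    intro x hx
    have hx0 : 0 < x := lt_of_le_of_lt (by positivity) hx.1
    have hx1 : x < 1 := lt_of_lt_of_le hx.2 (by
      rw [div_le_one h2]
      exact_mod_cast hs m hm)
    obtain ⟨k, hk⟩ := exists_mem_Ioc_of_tendsto hbot htop hx0 hx1
    exact Set.mem_iUnion.mpr ⟨k, hx, hk⟩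
  calc (s.card : ℝ≥0∞) * 2⁻¹ ^ t = ∑ m ∈ s, volume (I m) := by simp [hvol]
    _ ≤ ∑ m ∈ s, ∑' k, volume (I m ∩ C k) := Finset.sum_le_sum hcover
    _ = ∑' k, ∑ m ∈ s, volume (I m ∩ C k) :=
      (Summable.tsum_finsetSum fun _ _ => ENNReal.summable).symm
    _ ≤ _ := by
      refine ENNReal.tsum_le_tsum fun k => le_min ?_ ?_
      · have := sum_measure_le_measure_univ (μ := volume.restrict (C k)) (s := s) (t := I)
          (fun m _ => measurableSet_Ioo.nullMeasurableSet)
          (fun m _ m' _ h => (hdisj h).aedisjoint)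
        rw [Measure.restrict_apply_univ, hC, Real.volume_Ioc] at this
        refine le_trans (Finset.sum_le_sum fun m _ => ?_) this
        rw [Measure.restrict_apply measurableSet_Ioo]
      -- A bad dyadic interval that meets the cell contains one of its two ends, up to the choice of
      -- half-open ends, so its index is one of two floors.
      · set p : Finset ℕ := {⌊2 ^ t * α k⌋₊, ⌊2 ^ t * α (k + 1)⌋₊} with hp
        have hzero : ∀ m ∈ s, m ∉ p → volume (I m ∩ C k) = 0 := by
          intro m hm hmp
          suffices h : I m ∩ C k = ∅ by simp [h]
          refine Set.eq_empty_of_forall_notMem ?_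
          rintro x ⟨⟨h1, h3⟩, ⟨h4, h5⟩⟩
          simp only [hp, Finset.mem_insert, Finset.mem_singleton, not_or] at hmp
          have hm0 : (0 : ℝ) ≤ m := m.cast_nonneg
          rcases lt_or_ge (α k) ((m : ℝ) / 2 ^ t) with hlt | hge
          · have h6 := hbad m hm k hlt
            rw [lt_div_iff₀ h2] at h6
            have h7 := h1.trans_le h5
            rw [div_lt_iff₀ h2] at h7
            refine hmp.2 (Eq.symm ?_)
            rw [Nat.floor_eq_iff (by linarith)]
            constructor <;> linarith
          · have h6 := h4.trans h3
            rw [lt_div_iff₀ h2] at h6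
            rw [div_le_iff₀ h2] at hge
            refine hmp.1 (Eq.symm ?_)
            rw [Nat.floor_eq_iff (by linarith)]
            constructor <;> linarith
        calc ∑ m ∈ s, volume (I m ∩ C k)
            ≤ ∑ m ∈ s ∪ p, volume (I m ∩ C k) :=
              Finset.sum_le_sum_of_subset Finset.subset_union_left
          _ = ∑ m ∈ p, volume (I m ∩ C k) := by
              symm
              refine Finset.sum_subset Finset.subset_union_right fun m hm hmp => ?_
              exact hzero m ((Finset.mem_union.mp hm).resolve_right hmp) hmp
          _ ≤ ∑ m ∈ p, 2⁻¹ ^ t :=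
              Finset.sum_le_sum fun m _ => (measure_mono Set.inter_subset_left).trans (hvol m).le
          _ ≤ 2 * 2⁻¹ ^ t := by
              rw [Finset.sum_const, nsmul_eq_mul]
              gcongr
              exact_mod_cast Finset.card_le_two

/-- With `L = log₂ (1 / p)` and `l = ⌊L⌋`, bound the first `l + 2` terms by `p` and sum the
geometric tail, which is `2⁻ˡ`. The overshoot from rounding `L` down is absorbed exactly: `(l + 2) *
p + p * (1 + (L - l)) = p * (L + 3)`. -/
lemma tsum_min_le {p : ℝ} (hp1 : p ≤ 1) :
    ∑' t : ℕ, min (ENNReal.ofReal p) (2 * 2⁻¹ ^ t)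
      ≤ ENNReal.ofReal (p * (Real.logb 2 (1 / p) + 3)) := by
  rcases le_or_gt p 0 with hp | hp
  · simp [ENNReal.ofReal_of_nonpos hp]
  set L := Real.logb 2 (1 / p) with hL
  have hL0 : 0 ≤ L := Real.logb_nonneg (by norm_num) (by rw [le_div_iff₀ hp]; linarith)
  have h2L : (2 : ℝ) ^ L = 1 / p := Real.rpow_logb (by norm_num) (by norm_num) (by positivity)
  set l := ⌊L⌋₊ with hl
  have hl1 : (l : ℝ) ≤ L := Nat.floor_le hL0
  have hl2 : L < l + 1 := Nat.lt_floor_add_one L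
  -- Since `2⁻ˡ = p * 2 ^ (L - l)` with `0 ≤ L - l ≤ 1`, this is Bernoulli's inequality `2 ^ s ≤ 1 +
  -- s` on `[0, 1]`.
  have hpow : ((2 : ℝ) ^ l)⁻¹ ≤ p * (1 + (L - l)) := by
    have h : (1 + 1 : ℝ) ^ (L - l) ≤ 1 + (L - l) * 1 :=
      rpow_one_add_le_one_add_mul_self (by norm_num) (by linarith) (by linarith)
    rw [one_add_one_eq_two, Real.rpow_sub (by norm_num), h2L, Real.rpow_natCast] at h
    calc ((2 : ℝ) ^ l)⁻¹ = p * (1 / p / 2 ^ l) := by field_simp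
      _ ≤ p * (1 + (L - l)) := by
        apply mul_le_mul_of_nonneg_left _ hp.le
        linarith
  rw [← ENNReal.summable.sum_add_tsum_nat_add' (k := l + 2)]
  calc _ ≤ ∑ t ∈ Finset.range (l + 2), ENNReal.ofReal p
        + ∑' t : ℕ, 2 * 2⁻¹ ^ (t + (l + 2)) := by
        gcongr
        · exact min_le_left _ _
        · exact min_le_right _ _
    _ = ENNReal.ofReal ((l + 2) * p) + ENNReal.ofReal ((2 ^ l)⁻¹) := by
        congr 1
        · rw [Finset.sum_const, Finset.card_range, nsmul_eq_mul, ENNReal.ofReal_mul (by positivity)]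
          congr 1
          rw [← ENNReal.ofReal_natCast]
          push_cast
          rfl
        · rw [ENNReal.tsum_mul_left]
          simp_rw [pow_add _ _ (l + 2)]
          rw [ENNReal.tsum_mul_right, ENNReal.tsum_geometric, ENNReal.one_sub_inv_two, inv_inv,
            ENNReal.ofReal_inv_of_pos (by positivity), ENNReal.ofReal_pow (by norm_num),
            ← ENNReal.inv_pow, pow_add, ENNReal.ofReal_ofNat]
          have h : (2 : ℝ≥0∞) * 2⁻¹ = 1 := ENNReal.mul_inv_cancel (by simp) (by simp)
          rw [← pow_add, ENNReal.inv_pow, pow_add]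
          calc (2 : ℝ≥0∞) * (2 * (2⁻¹ ^ l * 2⁻¹ ^ 2)) = (2 * 2⁻¹) * (2 * 2⁻¹) * 2⁻¹ ^ l := by ring
            _ = _ := by rw [h, one_mul, one_mul, ENNReal.inv_pow]
    _ = ENNReal.ofReal ((l + 2) * p + (2 ^ l)⁻¹) :=
        (ENNReal.ofReal_add (by positivity) (by positivity)).symm
    _ ≤ _ := by
        apply ENNReal.ofReal_le_ofReal
        linarith

/-! ### Expected number of coins -/

section Coins

variable {Ω : Type*} [MeasurableSpace Ω] {Q : Measure Ω}
  {B : ℕ → Ω → Bool}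

lemma measurable_prefixNat (hB : IsFairCoins Q B) (t : ℕ) :
    Measurable fun ω => prefixNat (fun j => B j ω) t := by
  induction t with
  | zero => exact measurable_const
  | succ t ih =>
    have : Measurable fun ω => (B t ω).toNat :=
      (measurable_from_top (f := Bool.toNat)).comp (hB.measurable t)
    exact (ih.const_mul 2).add this

lemma measure_coin_eq [IsProbabilityMeasure Q] (hB : IsFairCoins Q B) (j : ℕ) (c : Bool) : Q (B j ⁻¹' {c}) = 2⁻¹ := by
  have ht : Q (B j ⁻¹' {true}) = 2⁻¹ := by
    have := hB.fair j
    rw [one_div] at this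
    exact this
  cases c with
  | true => exact ht
  | false =>
    have h : B j ⁻¹' {false} = (B j ⁻¹' {true})ᶜ := by
      ext ω
      simp
    rw [h, prob_compl_eq_one_sub (hB.measurable j (measurableSet_singleton _)), ht,
      ENNReal.one_sub_inv_two]

lemma measure_prefixNat_eq_le [IsProbabilityMeasure Q] (hB : IsFairCoins Q B) (t m : ℕ) :
    Q {ω | prefixNat (fun j => B j ω) t = m} ≤ 2⁻¹ ^ t := by
  rcases Set.eq_empty_or_nonempty {ω | prefixNat (fun j => B j ω) t = m} with h | ⟨ω₀, h₀⟩
  · simp [h]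
  have hprod := hB.indep.measure_inter_preimage_eq_mul (Finset.range t)
    (sets := fun j => {B j ω₀}) (fun j _ => measurableSet_singleton _)
  simp only [measure_coin_eq hB, Finset.prod_const, Finset.card_range] at hprod
  rw [← hprod]
  refine measure_mono fun ω hω => ?_
  simp only [Set.mem_iInter, Finset.mem_range, Set.mem_preimage, Set.mem_singleton_iff]
  intro j hj
  exact eq_of_prefixNat_eq (hω.trans h₀.symm) j hj

/-- Every `t` before the first stopping time contributes `1`. If the method never stops, both sides
are infinite. -/
lemma inversionCoins_le_tsum (F : ℝ → ℝ) (ε : ℝ) (b : ℕ → Bool) :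
    ((inversionCoins F ε b : ℕ∞) : ℝ≥0∞)
      ≤ ∑' t : ℕ, {t | ¬ InversionStops F ε b t}.indicator (fun _ => (1 : ℝ≥0∞)) t := by
  classical
  by_cases h : ∃ t, InversionStops F ε b t
  · have hle : inversionCoins F ε b ≤ (Nat.find h : ℕ∞) := iInf₂_le _ (Nat.find_spec h)
    calc ((inversionCoins F ε b : ℕ∞) : ℝ≥0∞) ≤ ((Nat.find h : ℕ∞) : ℝ≥0∞) := by
          exact_mod_cast hle
      _ = ∑ t ∈ Finset.range (Nat.find h),
            {t | ¬ InversionStops F ε b t}.indicator (fun _ => (1 : ℝ≥0∞)) t := by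
          rw [Finset.sum_congr rfl fun t ht =>
            Set.indicator_of_mem (show t ∈ {t | ¬ InversionStops F ε b t} from
              Nat.find_min h (Finset.mem_range.mp ht)) _]
          simp
      _ ≤ _ := ENNReal.sum_le_tsum _
  · push Not at h
    have : {t | ¬ InversionStops F ε b t} = Set.univ := Set.eq_univ_of_forall h
    simp [this]

/-- The inversion method is at least as fast as the interval algorithm for a partition of the
line into intervals of length at most `2 ε`. -/
theorem lintegral_inversionCoins_le [IsProbabilityMeasure Q] (hB : IsFairCoins Q B) {F : ℝ → ℝ} (hF : Monotone F)
    (hbot : Tendsto F atBot (𝓝 0)) (htop : Tendsto F atTop (𝓝 1)) {ε : ℝ} {c : ℤ → ℝ}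
    (hcbot : Tendsto c atBot atBot) (hctop : Tendsto c atTop atTop)
    (hc : ∀ k, c (k + 1) - c k ≤ 2 * ε) :
    ∫⁻ ω, ((inversionCoins F ε (fun j => B j ω) : ℕ∞) : ℝ≥0∞) ∂Q
      ≤ ∑' k, ENNReal.ofReal ((F (c (k + 1)) - F (c k)) *
          (Real.logb 2 (1 / (F (c (k + 1)) - F (c k))) + 3)) := by
  classical
  have hF0 : ∀ x, 0 ≤ F x := fun x => hF.le_of_tendsto hbot x
  have hF1 : ∀ x, F x ≤ 1 := fun x => hF.ge_of_tendsto htop x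
  set N : ℕ → Ω → ℕ := fun t ω => prefixNat (fun j => B j ω) t with hN
  have hNm : ∀ t, Measurable (N t) := measurable_prefixNat hB
  set good : ℕ → ℕ → Prop := fun t m =>
    ∃ k, F (c k) < (m : ℝ) / 2 ^ t ∧ ((m : ℝ) + 1) / 2 ^ t ≤ F (c (k + 1)) with hgood
  set bad : ℕ → Finset ℕ := fun t => (Finset.range (2 ^ t)).filter fun m => ¬ good t m with hbad
  have hmem : ∀ t ω, ¬ InversionStops F ε (fun j => B j ω) t → N t ω ∈ bad t := by
    intro t ω h
    rw [hbad, Finset.mem_filter]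
    refine ⟨Finset.mem_range.mpr (prefixNat_lt _ _), ?_⟩
    rintro ⟨k, h1, h2⟩
    exact h (inversionStops_of_subset hF (hc k) h1 h2)
  have hQ : ∀ t, Q (N t ⁻¹' (bad t)) ≤ (bad t).card * 2⁻¹ ^ t := by
    intro t
    have : N t ⁻¹' (bad t) = ⋃ m ∈ bad t, {ω | N t ω = m} := by
      ext ω
      simp
    rw [this]
    refine (measure_biUnion_finset_le _ _).trans ?_
    refine (Finset.sum_le_sum fun m _ => measure_prefixNat_eq_le hB t m).trans ?_
    simp
  -- The bound by indicators of measurable events is pointwise, so measurability of `T` plays no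
  -- role.
  calc _ ≤ ∫⁻ ω, ∑' t, (N t ⁻¹' (bad t)).indicator (fun _ => (1 : ℝ≥0∞)) ω ∂Q := by
        refine lintegral_mono fun ω => (inversionCoins_le_tsum _ _ _).trans ?_
        refine ENNReal.tsum_le_tsum fun t => ?_
        by_cases h : InversionStops F ε (fun j => B j ω) t
        · rw [Set.indicator_of_notMem (by simpa using h)]
          exact zero_le
        · rw [Set.indicator_of_mem (show t ∈ {t | ¬ InversionStops F ε (fun j => B j ω) t} from h),
            Set.indicator_of_mem (show ω ∈ N t ⁻¹' (bad t) from hmem t ω h)]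
    _ = ∑' t, Q (N t ⁻¹' (bad t)) := by
        have hm : ∀ t, MeasurableSet (N t ⁻¹' (bad t)) := fun t =>
          hNm t (Finset.measurableSet _)
        rw [lintegral_tsum fun t => (measurable_const.indicator (hm t)).aemeasurable]
        refine tsum_congr fun t => ?_
        rw [lintegral_indicator_const (hm t), one_mul]
    _ ≤ ∑' t, ∑' k, min (ENNReal.ofReal (F (c (k + 1)) - F (c k))) (2 * 2⁻¹ ^ t) := by
        refine ENNReal.tsum_le_tsum fun t => (hQ t).trans ?_
        refine card_mul_le_tsum_min (α := fun k => F (c k)) (hbot.comp hcbot) (htop.comp hctop)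
          t _ (fun m hm => Finset.mem_range.mp (Finset.mem_filter.mp hm).1) ?_
        intro m hm k hk
        by_contra! hle
        exact (Finset.mem_filter.mp hm).2 ⟨k, hk, hle⟩
    _ = ∑' k, ∑' t : ℕ, min (ENNReal.ofReal (F (c (k + 1)) - F (c k))) (2 * 2⁻¹ ^ t) :=
        ENNReal.tsum_comm
    _ ≤ _ := ENNReal.tsum_le_tsum fun k => tsum_min_le (by linarith [hF0 (c k), hF1 (c (k + 1))])

end Coins

/-! ### Entropy of grids and relative entropy of histograms -/

section GridEntropy

open InformationTheory

/-- The probability of the cell `[k / n, (k + 1) / n)`. -/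
noncomputable def gridMass (μ : Measure ℝ) (n : ℕ) (k : ℤ) : ℝ := μ.real {x | ⌊(n : ℝ) * x⌋ = k}

/-- The density of `μ` averaged over the cells `[k / n, (k + 1) / n)`. -/
noncomputable def gridDensity (μ : Measure ℝ) (n : ℕ) (x : ℝ) : ℝ :=
  n * gridMass μ n ⌊(n : ℝ) * x⌋

/-- The integrand of the relative entropy, in bits, of a density `x` with respect to `y`. -/
noncomputable def relDensity (x y : ℝ) : ℝ := y * klFun (x / y) / Real.log 2

/-- The entropy, in bits, of the partition of `ℝ` into the cells `[k / n, (k + 1) / n)`. -/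
noncomputable def gridEntropy (μ : Measure ℝ) (n : ℕ) : ℝ≥0∞ :=
  ∑' k, ENNReal.ofReal (gridMass μ n k * Real.logb 2 (1 / gridMass μ n k))

lemma setOf_floor_mul_eq {n : ℕ} (hn : 0 < n) (k : ℤ) :
    {x : ℝ | ⌊(n : ℝ) * x⌋ = k} = Set.Ico ((k : ℝ) / n) (((k + 1 : ℤ) : ℝ) / n) := by
  have hn' : (0 : ℝ) < n := by exact_mod_cast hn
  ext x
  simp only [Set.mem_ofPred_eq, Int.floor_eq_iff, Set.mem_Ico, div_le_iff₀ hn', lt_div_iff₀ hn',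
    mul_comm x]
  push_cast
  rfl

lemma measurable_floor_mul (n : ℕ) : Measurable fun x : ℝ => ⌊(n : ℝ) * x⌋ :=
  Int.measurable_floor.comp (measurable_const_mul _)

lemma measurable_gridDensity (μ : Measure ℝ) (n : ℕ) : Measurable (gridDensity μ n) :=
  ((measurable_from_top (f := gridMass μ n)).comp (measurable_floor_mul n)).const_mul _

lemma measurable_relDensity {f g : ℝ → ℝ} (hf : Measurable f) (hg : Measurable g) :
    Measurable fun x => relDensity (f x) (g x) :=
  (hg.mul (measurable_klFun.comp (hf.div hg))).div_const _

lemma gridMass_nonneg (μ : Measure ℝ) (n : ℕ) (k : ℤ) : 0 ≤ gridMass μ n k := measureReal_nonneg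

lemma gridDensity_nonneg (μ : Measure ℝ) (n : ℕ) (x : ℝ) : 0 ≤ gridDensity μ n x :=
  mul_nonneg n.cast_nonneg (gridMass_nonneg _ _ _)

lemma gridMass_le_one (μ : Measure ℝ) [IsProbabilityMeasure μ] (n : ℕ) (k : ℤ) :
    gridMass μ n k ≤ 1 := measureReal_le_one

lemma gridDensity_one (μ : Measure ℝ) (x : ℝ) : gridDensity μ 1 x = gridMass μ 1 ⌊x⌋ := by
  simp [gridDensity]

lemma relDensity_nonneg {x y : ℝ} (hx : 0 ≤ x) (hy : 0 ≤ y) : 0 ≤ relDensity x y :=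
  div_nonneg (mul_nonneg hy (klFun_nonneg (div_nonneg hx hy))) (Real.log_nonneg (by norm_num))

lemma logb_one_div_nonneg {p : ℝ} (h0 : 0 ≤ p) (h1 : p ≤ 1) : 0 ≤ Real.logb 2 (1 / p) := by
  rcases h0.eq_or_lt with rfl | h0
  · simp
  · exact Real.logb_nonneg (by norm_num) (by rw [le_div_iff₀ h0]; linarith)

/-- `y * klFun (x / y) = x * log (x / y) + y - x`, so the two terms over `log 2` are its linear
part; they cancel after integrating two probability densities. The hypothesis is absolute
continuity, needed because `relDensity x 0 = 0` by the convention for division by zero. -/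
lemma mul_logb_add_relDensity {x y : ℝ} (h : y = 0 → x = 0) :
    x * Real.logb 2 (1 / x) + relDensity x y + x / Real.log 2
      = x * Real.logb 2 (1 / y) + y / Real.log 2 := by
  have hl : Real.log 2 ≠ 0 := (Real.log_pos (by norm_num)).ne'
  by_cases hy : y = 0
  · simp [hy, h hy, relDensity]
  by_cases hx : x = 0
  · simp [hx, relDensity, klFun_zero]
  rw [relDensity, klFun_apply, Real.log_div hx hy, Real.logb, Real.logb, one_div, one_div,
    Real.log_inv, Real.log_inv]
  field_simp
  ring

lemma lintegral_comp_floor_mul (μ : Measure ℝ) (n : ℕ) (G : ℤ → ℝ≥0∞) :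
    ∫⁻ x, G ⌊(n : ℝ) * x⌋ ∂μ = ∑' k, G k * μ {x | ⌊(n : ℝ) * x⌋ = k} := by
  rw [← lintegral_map (f := G) measurable_from_top (measurable_floor_mul n), lintegral_countable']
  refine tsum_congr fun k => ?_
  rw [Measure.map_apply (measurable_floor_mul n) (measurableSet_singleton k)]
  rfl

lemma volume_floor_mul_eq {n : ℕ} (hn : 0 < n) (k : ℤ) :
    volume {x : ℝ | ⌊(n : ℝ) * x⌋ = k} = (n : ℝ≥0∞)⁻¹ := by
  have hn' : (0 : ℝ) < n := by exact_mod_cast hn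
  rw [setOf_floor_mul_eq hn, Real.volume_Ico, ← sub_div]
  push_cast
  rw [add_sub_cancel_left, one_div, ENNReal.ofReal_inv_of_pos hn', ENNReal.ofReal_natCast]

lemma ofReal_gridMass (μ : Measure ℝ) [IsFiniteMeasure μ] (n : ℕ) (k : ℤ) :
    ENNReal.ofReal (gridMass μ n k) = μ {x | ⌊(n : ℝ) * x⌋ = k} := ofReal_measureReal

lemma lintegral_natCast_mul_comp_floor {n : ℕ} (hn : 0 < n) (G : ℤ → ℝ≥0∞) :
    ∫⁻ x : ℝ, n * G ⌊(n : ℝ) * x⌋ = ∑' k, G k := by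
  rw [lintegral_comp_floor_mul volume n fun k => n * G k]
  refine tsum_congr fun k => ?_
  rw [volume_floor_mul_eq hn, mul_comm (n : ℝ≥0∞), mul_assoc,
    ENNReal.mul_inv_cancel (by exact_mod_cast hn.ne') (by simp), mul_one]

lemma lintegral_gridDensity_mul (μ : Measure ℝ) [IsFiniteMeasure μ] {n : ℕ} (hn : 0 < n)
    (G : ℤ → ℝ≥0∞) :
    ∫⁻ x, ENNReal.ofReal (gridDensity μ n x) * G ⌊(n : ℝ) * x⌋ = ∫⁻ x, G ⌊(n : ℝ) * x⌋ ∂μ := by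
  rw [lintegral_comp_floor_mul μ]
  simp_rw [← ofReal_gridMass]
  rw [← lintegral_natCast_mul_comp_floor hn]
  refine lintegral_congr fun x => ?_
  rw [gridDensity, ENNReal.ofReal_mul n.cast_nonneg, ENNReal.ofReal_natCast]
  ring

lemma floor_eq_floor_mul_ediv {n : ℕ} (hn : 0 < n) (x : ℝ) : ⌊x⌋ = ⌊(n : ℝ) * x⌋ / n := by
  have hn' : (n : ℝ) ≠ 0 := by exact_mod_cast hn.ne'
  rw [← Int.floor_div_natCast, mul_div_cancel_left₀ _ hn']

lemma gridDensity_eq_zero_of_one (μ : Measure ℝ) [IsFiniteMeasure μ] {n : ℕ} (hn : 0 < n) {x : ℝ}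
    (h : gridDensity μ 1 x = 0) : gridDensity μ n x = 0 := by
  rw [gridDensity_one] at h
  have : gridMass μ n ⌊(n : ℝ) * x⌋ ≤ gridMass μ 1 ⌊x⌋ := by
    refine measureReal_mono fun y hy => ?_
    simp only [Set.mem_ofPred_eq, Nat.cast_one, one_mul] at hy ⊢
    rw [floor_eq_floor_mul_ediv hn, floor_eq_floor_mul_ediv hn x, hy]
  rw [gridDensity, le_antisymm (this.trans h.le) (gridMass_nonneg _ _ _), mul_zero]

lemma lintegral_logb_gridMass_one (μ : Measure ℝ) [IsProbabilityMeasure μ] :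
    ∫⁻ x, ENNReal.ofReal (Real.logb 2 (1 / gridDensity μ 1 x)) ∂μ = gridEntropy μ 1 := by
  simp_rw [gridDensity, Nat.cast_one, one_mul]
  have := lintegral_comp_floor_mul μ 1 fun k =>
    ENNReal.ofReal (Real.logb 2 (1 / gridMass μ 1 k))
  simp only [Nat.cast_one, one_mul] at this
  rw [this, gridEntropy]
  refine tsum_congr fun k => ?_
  rw [ENNReal.ofReal_mul (gridMass_nonneg _ _ _), ofReal_gridMass, mul_comm]
  simp

/-- Splitting the unit cells into `n` parts increases the entropy by `log₂ n`, minus the relative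
entropy of the two histograms. -/
theorem gridEntropy_add_lintegral_relDensity (μ : Measure ℝ) [IsProbabilityMeasure μ] {n : ℕ}
    (hn : 0 < n) :
    gridEntropy μ n
        + ∫⁻ x, ENNReal.ofReal (relDensity (gridDensity μ n x) (gridDensity μ 1 x))
      = ENNReal.ofReal (Real.logb 2 n) + gridEntropy μ 1 := by
  have hn' : (0 : ℝ) < n := by exact_mod_cast hn
  have hl : 0 < Real.log 2 := Real.log_pos (by norm_num)
  have hln : 0 ≤ Real.logb 2 n := Real.logb_nonneg (by norm_num) (by exact_mod_cast hn)
  have hmass : ∀ {m : ℕ}, 0 < m → ∫⁻ x, ENNReal.ofReal (gridDensity μ m x / Real.log 2)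
      = ENNReal.ofReal (1 / Real.log 2) := by
    intro m hm
    have := lintegral_gridDensity_mul μ hm fun _ => ENNReal.ofReal (1 / Real.log 2)
    rw [lintegral_const, measure_univ, mul_one] at this
    rw [← this]
    refine lintegral_congr fun x => ?_
    rw [← ENNReal.ofReal_mul (gridDensity_nonneg _ _ _), mul_one_div]
  have h1 : ∫⁻ x, ENNReal.ofReal (n * (gridMass μ n ⌊(n : ℝ) * x⌋ *
      Real.logb 2 (1 / gridMass μ n ⌊(n : ℝ) * x⌋))) = gridEntropy μ n := by
    rw [gridEntropy, ← lintegral_natCast_mul_comp_floor hn]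
    refine lintegral_congr fun x => ?_
    rw [ENNReal.ofReal_mul n.cast_nonneg, ENNReal.ofReal_natCast]
  have h2 : ∫⁻ x, ENNReal.ofReal (gridDensity μ n x * Real.logb 2 n)
      = ENNReal.ofReal (Real.logb 2 n) := by
    have := lintegral_gridDensity_mul μ hn fun _ => ENNReal.ofReal (Real.logb 2 n)
    rw [lintegral_const, measure_univ, mul_one] at this
    rw [← this]
    refine lintegral_congr fun x => ?_
    rw [← ENNReal.ofReal_mul (gridDensity_nonneg _ _ _)]
  have h3 : ∫⁻ x, ENNReal.ofReal (gridDensity μ n x * Real.logb 2 (1 / gridDensity μ 1 x))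
      = gridEntropy μ 1 := by
    -- The unit cell of `x` is determined by its fine cell `k` through integer division `k / n`, so
    -- `log₂ (1 / g 1)` has the same integral against `g n` as against `μ`.
    have := lintegral_gridDensity_mul μ hn fun k =>
      ENNReal.ofReal (Real.logb 2 (1 / gridMass μ 1 (k / n)))
    simp_rw [← floor_eq_floor_mul_ediv hn, ← gridDensity_one] at this
    rw [lintegral_logb_gridMass_one] at this
    rw [← this]
    refine lintegral_congr fun x => ?_
    rw [← ENNReal.ofReal_mul (gridDensity_nonneg _ _ _)]
  have hm1 := measurable_gridDensity μ 1
  have hmn := measurable_gridDensity μ n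
  have hlog : ∀ x, 0 ≤ Real.logb 2 (1 / gridDensity μ 1 x) := fun x => by
    rw [gridDensity_one]
    exact logb_one_div_nonneg (gridMass_nonneg _ _ _) (gridMass_le_one _ _ _)
  -- Pointwise chain rule, using `g n = n * gridMass`; every term is nonnegative, so it can be
  -- integrated in `[0, ∞]` before any finiteness is known.
  have key : ∀ x, ENNReal.ofReal (n * (gridMass μ n ⌊(n : ℝ) * x⌋ *
        Real.logb 2 (1 / gridMass μ n ⌊(n : ℝ) * x⌋)))
        + ENNReal.ofReal (relDensity (gridDensity μ n x) (gridDensity μ 1 x))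
        + ENNReal.ofReal (gridDensity μ n x / Real.log 2)
      = ENNReal.ofReal (gridDensity μ n x * Real.logb 2 n)
        + ENNReal.ofReal (gridDensity μ n x * Real.logb 2 (1 / gridDensity μ 1 x))
        + ENNReal.ofReal (gridDensity μ 1 x / Real.log 2) := by
    intro x
    have a1 := gridDensity_nonneg μ n x
    have a2 := gridDensity_nonneg μ 1 x
    have a3 : 0 ≤ gridMass μ n ⌊(n : ℝ) * x⌋ * Real.logb 2 (1 / gridMass μ n ⌊(n : ℝ) * x⌋) :=
      mul_nonneg (gridMass_nonneg _ _ _)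
        (logb_one_div_nonneg (gridMass_nonneg _ _ _) (gridMass_le_one _ _ _))
    have a4 := relDensity_nonneg a1 a2
    have a5 := hlog x
    rw [← ENNReal.ofReal_add (by positivity) a4, ← ENNReal.ofReal_add (by positivity)
      (by positivity), ← ENNReal.ofReal_add (by positivity) (by positivity),
      ← ENNReal.ofReal_add (by positivity) (by positivity), add_assoc (_ * Real.logb 2 n),
      ← mul_logb_add_relDensity (gridDensity_eq_zero_of_one μ hn), ← add_assoc, ← add_assoc]
    congr 3
    rw [gridDensity]
    by_cases h0 : gridMass μ n ⌊(n : ℝ) * x⌋ = 0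
    · simp [h0]
    · rw [one_div, one_div, Real.logb_inv, Real.logb_inv, Real.logb_mul hn'.ne' h0]
      ring
  have hint := lintegral_congr (μ := volume) key
  have hm : Measurable fun x => ENNReal.ofReal
      (relDensity (gridDensity μ n x) (gridDensity μ 1 x)) :=
    (measurable_relDensity hmn hm1).ennreal_ofReal
  rw [lintegral_add_right _ (hmn.div_const _).ennreal_ofReal, lintegral_add_right _ hm,
    lintegral_add_right _ (hm1.div_const _).ennreal_ofReal,
    lintegral_add_left (hmn.mul_const _).ennreal_ofReal, h1, h2, h3, hmass hn,
    hmass one_pos] at hint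
  exact (ENNReal.add_left_inj ENNReal.ofReal_ne_top).mp hint

/-! ### Comparison of the density with its histograms -/

section Density

variable {μ : Measure ℝ} [IsProbabilityMeasure μ] {f : ℝ → ℝ}

lemma ae_eq_zero_of_gridDensity_one (hfm : Measurable f) (hf0 : ∀ x, 0 ≤ f x)
    (hμ : μ = volume.withDensity fun x => ENNReal.ofReal (f x)) :
    ∀ᵐ x, gridDensity μ 1 x = 0 → f x = 0 := by
  have h : ∀ᵐ x ∂μ, gridDensity μ 1 x ≠ 0 := by
    rw [ae_iff]
    refine measure_mono_null (t := ⋃ k ∈ {k : ℤ | gridMass μ 1 k = 0},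
      {x : ℝ | ⌊((1 : ℕ) : ℝ) * x⌋ = k}) (fun x hx => ?_) ?_
    · simp only [ne_eq, not_not, Set.mem_ofPred_eq, gridDensity_one] at hx
      simp [hx]
    · refine (measure_biUnion_null_iff (Set.to_countable _)).mpr fun k hk => ?_
      rw [← ofReal_gridMass, show gridMass μ 1 k = 0 from hk, ENNReal.ofReal_zero]
  rw [hμ, ae_withDensity_iff hfm.ennreal_ofReal, ← hμ] at h
  filter_upwards [h] with x hx h0
  by_contra hne
  exact hx (by simpa using lt_of_le_of_ne (hf0 x) (Ne.symm hne)) h0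

/-- This is `ℰ(f) = H 1 - D(f ‖ g 1)`, obtained by integrating `mul_logb_add_relDensity`. The
negative part of the entropy is moved to the other side so that no `∞ - ∞` can occur. -/
theorem lintegral_entropy_add_relDensity (hfm : Measurable f) (hf0 : ∀ x, 0 ≤ f x)
    (hμ : μ = volume.withDensity fun x => ENNReal.ofReal (f x)) :
    (∫⁻ x, ENNReal.ofReal (f x * Real.logb 2 (1 / f x)))
        + ∫⁻ x, ENNReal.ofReal (relDensity (f x) (gridDensity μ 1 x))
      = (∫⁻ x, ENNReal.ofReal (-(f x * Real.logb 2 (1 / f x)))) + gridEntropy μ 1 := by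
  have hl : 0 < Real.log 2 := Real.log_pos (by norm_num)
  have hm1 := measurable_gridDensity μ 1
  have hlogm : Measurable fun x => Real.logb 2 (1 / gridDensity μ 1 x) :=
    (hm1.const_div 1).log.div_const _
  have hf1 : ∫⁻ x, ENNReal.ofReal (f x) = 1 := by
    rw [← measure_univ (μ := μ), hμ, withDensity_apply _ MeasurableSet.univ, setLIntegral_univ]
  have hscale : ∀ {g : ℝ → ℝ}, Measurable g → (∀ x, 0 ≤ g x) → ∫⁻ x, ENNReal.ofReal (g x) = 1 →
      ∫⁻ x, ENNReal.ofReal (g x / Real.log 2) = ENNReal.ofReal (1 / Real.log 2) := by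
    intro g hg hg0 h1
    rw [← one_mul (ENNReal.ofReal (1 / Real.log 2)), ← h1,
      ← lintegral_mul_const _ hg.ennreal_ofReal]
    refine lintegral_congr fun x => ?_
    rw [← ENNReal.ofReal_mul (hg0 x), mul_one_div]
  have hg1 : ∫⁻ x, ENNReal.ofReal (gridDensity μ 1 x) = 1 := by
    simpa using lintegral_gridDensity_mul μ one_pos fun _ => 1
  have h3 : ∫⁻ x, ENNReal.ofReal (f x * Real.logb 2 (1 / gridDensity μ 1 x))
      = gridEntropy μ 1 := by
    rw [← lintegral_logb_gridMass_one]
    conv_rhs => rw [hμ]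
    rw [lintegral_withDensity_eq_lintegral_mul _ hfm.ennreal_ofReal (by
      rw [← hμ]; exact hlogm.ennreal_ofReal), ← hμ]
    refine lintegral_congr fun x => ?_
    rw [Pi.mul_apply, ENNReal.ofReal_mul (hf0 x)]
  have hlog : ∀ x, 0 ≤ Real.logb 2 (1 / gridDensity μ 1 x) := fun x => by
    rw [gridDensity_one]
    exact logb_one_div_nonneg (gridMass_nonneg _ _ _) (gridMass_le_one _ _ _)
  have key : ∀ᵐ x, ENNReal.ofReal (f x * Real.logb 2 (1 / f x))
        + ENNReal.ofReal (relDensity (f x) (gridDensity μ 1 x))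
        + ENNReal.ofReal (f x / Real.log 2)
      = ENNReal.ofReal (-(f x * Real.logb 2 (1 / f x)))
        + ENNReal.ofReal (f x * Real.logb 2 (1 / gridDensity μ 1 x))
        + ENNReal.ofReal (gridDensity μ 1 x / Real.log 2) := by
    filter_upwards [ae_eq_zero_of_gridDensity_one hfm hf0 hμ] with x hx
    have a1 := hf0 x
    have a2 := gridDensity_nonneg μ 1 x
    have a4 := relDensity_nonneg a1 a2
    have a5 := mul_nonneg a1 (hlog x)
    have a6 : 0 ≤ f x / Real.log 2 := by positivity
    have a7 : 0 ≤ gridDensity μ 1 x / Real.log 2 := by positivity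
    have hid := mul_logb_add_relDensity hx
    rw [add_assoc, add_assoc, ← ENNReal.ofReal_add a4 a6, ← ENNReal.ofReal_add a5 a7, ← hid]
    rcases le_total 0 (f x * Real.logb 2 (1 / f x)) with h | h
    · rw [ENNReal.ofReal_of_nonpos (neg_nonpos.mpr h), zero_add,
        ← ENNReal.ofReal_add h (by positivity), add_assoc]
    · rw [ENNReal.ofReal_of_nonpos h, zero_add,
        ← ENNReal.ofReal_add (neg_nonneg.mpr h) (by rw [hid]; positivity)]
      congr 1
      ring
  have hint := lintegral_congr_ae key
  have hm : Measurable fun x => ENNReal.ofReal (relDensity (f x) (gridDensity μ 1 x)) :=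
    (measurable_relDensity hfm hm1).ennreal_ofReal
  have hflm : Measurable fun x =>
      ENNReal.ofReal (f x * Real.logb 2 (1 / gridDensity μ 1 x)) := (hfm.mul hlogm).ennreal_ofReal
  rw [lintegral_add_right _ (hfm.div_const _).ennreal_ofReal, lintegral_add_right _ hm,
    lintegral_add_right _ (hm1.div_const _).ennreal_ofReal,
    lintegral_add_right _ hflm, h3, hscale hfm hf0 hf1,
    hscale hm1 (gridDensity_nonneg μ 1) hg1] at hint
  exact (ENNReal.add_left_inj ENNReal.ofReal_ne_top).mp hint

/-- Lebesgue differentiation along the cells containing `x`. These are not centred at `x`, so the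
version for balls that merely contain `x` is used, each closed cell being the ball of radius `1 / (2
* n)` about its midpoint. -/
lemma ae_tendsto_gridDensity (hfm : Measurable f) (hf0 : ∀ x, 0 ≤ f x)
    (hμ : μ = volume.withDensity fun x => ENNReal.ofReal (f x)) :
    ∀ᵐ x, Tendsto (fun n => gridDensity μ n x) atTop (𝓝 (f x)) := by
  have hint : Integrable f := by
    refine ⟨hfm.aestronglyMeasurable, ?_⟩
    rw [hasFiniteIntegral_iff_ofReal (ae_of_all _ hf0), ← setLIntegral_univ,
      ← withDensity_apply _ MeasurableSet.univ, ← hμ, measure_univ]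
    exact ENNReal.one_lt_top
  filter_upwards [IsUnifLocDoublingMeasure.ae_tendsto_average volume
    hint.locallyIntegrable 1] with x hx
  have hδ : Tendsto (fun n : ℕ => 1 / (2 * (n : ℝ))) atTop (𝓝[>] 0) := by
    refine tendsto_nhdsWithin_iff.mpr ⟨?_, ?_⟩
    · exact tendsto_const_nhds.div_atTop
        (tendsto_natCast_atTop_atTop.const_mul_atTop (by norm_num))
    · filter_upwards [eventually_gt_atTop 0] with n hn
      have hn' : (0 : ℝ) < n := by exact_mod_cast hn
      exact Set.mem_Ioi.mpr (by positivity)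
  have hball : ∀ {n : ℕ}, 0 < n → ∀ k : ℤ,
      Metric.closedBall (((k : ℝ) + 1 / 2) / n) (1 / (2 * (n : ℝ)))
        = Set.Icc ((k : ℝ) / n) (((k + 1 : ℤ) : ℝ) / n) := by
    intro n hn k
    have hn' : (n : ℝ) ≠ 0 := by exact_mod_cast hn.ne'
    rw [Real.closedBall_eq_Icc]
    push_cast
    congr 1 <;> field_simp <;> ring
  refine (hx (fun n : ℕ => ((⌊(n : ℝ) * x⌋ : ℝ) + 1 / 2) / n) (fun n : ℕ => 1 / (2 * (n : ℝ)))
    hδ ?_).congr' ?_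
  · filter_upwards [eventually_gt_atTop 0] with n hn
    rw [one_mul, hball hn]
    have : x ∈ {y : ℝ | ⌊(n : ℝ) * y⌋ = ⌊(n : ℝ) * x⌋} := rfl
    rw [setOf_floor_mul_eq hn] at this
    exact Set.Ico_subset_Icc_self this
  · filter_upwards [eventually_gt_atTop 0] with n hn
    rw [hball hn, gridDensity, gridMass, setOf_floor_mul_eq hn, setAverage_eq,
      Measure.real, Measure.real, Real.volume_Icc, integral_Icc_eq_integral_Ico,
      integral_eq_lintegral_of_nonneg_ae (ae_of_all _ hf0) hfm.aestronglyMeasurable]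
    rw [← withDensity_apply _ measurableSet_Ico, ← hμ]
    rw [smul_eq_mul, ← sub_div]
    push_cast
    rw [add_sub_cancel_left, ENNReal.toReal_ofReal (by positivity), one_div, inv_inv]

/-- Fatou's lemma together with continuity of `klFun`; where `g 1` vanishes, both integrands are
`0`. -/
lemma lintegral_relDensity_le_liminf (hfm : Measurable f) (hf0 : ∀ x, 0 ≤ f x)
    (hμ : μ = volume.withDensity fun x => ENNReal.ofReal (f x)) :
    ∫⁻ x, ENNReal.ofReal (relDensity (f x) (gridDensity μ 1 x))
      ≤ liminf (fun n => ∫⁻ x, ENNReal.ofReal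
          (relDensity (gridDensity μ n x) (gridDensity μ 1 x))) atTop := by
  refine le_trans (le_of_eq (lintegral_congr_ae ?_)) (lintegral_liminf_le fun n =>
    (measurable_relDensity (measurable_gridDensity μ n)
      (measurable_gridDensity μ 1)).ennreal_ofReal)
  filter_upwards [ae_tendsto_gridDensity hfm hf0 hμ] with x hx
  refine (Tendsto.liminf_eq ((ENNReal.continuous_ofReal.tendsto _).comp ?_)).symm
  have := (continuous_klFun.tendsto _).comp (hx.div_const (gridDensity μ 1 x))
  exact (this.const_mul _).div_const _

/-- The upper half of Rényi's theorem on the entropy of fine partitions. -/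
theorem exists_gridEntropy_le (hfm : Measurable f) (hf0 : ∀ x, 0 ≤ f x)
    (hμ : μ = volume.withDensity fun x => ENNReal.ofReal (f x)) (hH : gridEntropy μ 1 ≠ ∞)
    (hneg : ∫⁻ x, ENNReal.ofReal (-(f x * Real.logb 2 (1 / f x))) ≠ ∞) :
    ∫⁻ x, ENNReal.ofReal (f x * Real.logb 2 (1 / f x)) ≠ ∞ ∧
    ∃ δ : ℕ → ℝ, Tendsto δ atTop (𝓝 0) ∧ ∀ n, 0 < n → gridEntropy μ n ≠ ∞ ∧
      (gridEntropy μ n).toReal ≤ Real.logb 2 n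
        + ((∫⁻ x, ENNReal.ofReal (f x * Real.logb 2 (1 / f x))).toReal
          - (∫⁻ x, ENNReal.ofReal (-(f x * Real.logb 2 (1 / f x)))).toReal) + δ n := by
  have hE := lintegral_entropy_add_relDensity hfm hf0 hμ
  have hlim := lintegral_relDensity_le_liminf hfm hf0 hμ
  have hS := fun n (hn : 0 < n) => gridEntropy_add_lintegral_relDensity μ hn
  set A := ∫⁻ x, ENNReal.ofReal (f x * Real.logb 2 (1 / f x))
  set N := ∫⁻ x, ENNReal.ofReal (-(f x * Real.logb 2 (1 / f x)))
  set D := ∫⁻ x, ENNReal.ofReal (relDensity (f x) (gridDensity μ 1 x))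
  set Dn : ℕ → ℝ≥0∞ := fun n => ∫⁻ x, ENNReal.ofReal
    (relDensity (gridDensity μ n x) (gridDensity μ 1 x))
  have hsum : A + D ≠ ∞ := by rw [hE]; exact ENNReal.add_ne_top.mpr ⟨hneg, hH⟩
  obtain ⟨hA, hD⟩ := ENNReal.add_ne_top.mp hsum
  have hSn : ∀ n, 0 < n → gridEntropy μ n ≠ ∞ ∧ Dn n ≠ ∞ := fun n hn => by
    rw [← ENNReal.add_ne_top, hS n hn]
    exact ENNReal.add_ne_top.mpr ⟨ENNReal.ofReal_ne_top, hH⟩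
  -- Subtracting the two chain rules gives `H n = log₂ n + ℰ(f) + (D - Dn n)`. Fatou controls only
  -- one side of `D - Dn n`, so the error is its positive part.
  refine ⟨hA, fun n => max 0 (D.toReal - (Dn n).toReal), ?_, fun n hn => ⟨(hSn n hn).1, ?_⟩⟩
  · refine tendsto_order.mpr ⟨fun a ha => .of_forall fun n => ha.trans_le (le_max_left _ _),
      fun a ha => ?_⟩
    rcases lt_or_ge D.toReal a with h | h
    · filter_upwards with n
      exact max_lt ha (by linarith [ENNReal.toReal_nonneg (a := Dn n)])
    · have hlt : ENNReal.ofReal (D.toReal - a) < D := by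
        rw [ENNReal.ofReal_lt_iff_lt_toReal (by linarith) hD]
        linarith
      filter_upwards [eventually_lt_of_lt_liminf (hlt.trans_le hlim), eventually_gt_atTop 0]
        with n hn hn0
      rw [ENNReal.ofReal_lt_iff_lt_toReal (by linarith) (hSn n hn0).2] at hn
      exact max_lt ha (by linarith)
  · have h1 := congrArg ENNReal.toReal hE
    have h2 := congrArg ENNReal.toReal (hS n hn)
    rw [ENNReal.toReal_add hA hD, ENNReal.toReal_add hneg hH] at h1
    rw [ENNReal.toReal_add (hSn n hn).1 (hSn n hn).2, ENNReal.toReal_add ENNReal.ofReal_ne_top hH,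
      ENNReal.toReal_ofReal (Real.logb_nonneg (by norm_num) (by exact_mod_cast hn))] at h2
    have h3 := le_max_right 0 (D.toReal - (Dn n).toReal)
    linarith

end Density

end GridEntropy

/-! ### Assembly of the bound -/

/-- Increments of the distribution function measure left-open cells, the floor gives left-closed
ones; they agree because there are no atoms. -/
lemma cdf_sub_cdf_eq_gridMass (μ : Measure ℝ) [IsProbabilityMeasure μ] [NullSingletonClass μ]
    {n : ℕ} (hn : 0 < n) (k : ℤ) :
    cdf μ (((k + 1 : ℤ) : ℝ) / n) - cdf μ ((k : ℝ) / n) = gridMass μ n k := by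
  have hle : (k : ℝ) / n ≤ ((k + 1 : ℤ) : ℝ) / n := by
    push_cast
    gcongr
    linarith
  rw [gridMass, setOf_floor_mul_eq hn, Measure.real, measure_congr Ico_ae_eq_Ioc]
  conv_rhs => rw [← measure_cdf μ]
  rw [StieltjesFunction.measure_Ioc,
    ENNReal.toReal_ofReal (sub_nonneg.mpr (monotone_cdf μ hle))]

lemma tsum_ofReal_gridMass (μ : Measure ℝ) [IsProbabilityMeasure μ] (n : ℕ) :
    ∑' k, ENNReal.ofReal (gridMass μ n k) = 1 := by
  have := lintegral_comp_floor_mul μ n fun _ => 1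
  simp_rw [one_mul, ← ofReal_gridMass, lintegral_const, measure_univ, one_mul] at this
  exact this.symm

lemma gridEntropy_map_one {Ω : Type*} [MeasurableSpace Ω] (P : Measure Ω) {X : Ω → ℝ}
    (hX : AEMeasurable X P) : gridEntropy (P.map X) 1 = floorEntropy P X := by
  have h : ∀ k, gridMass (P.map X) 1 k = P.real {ω | ⌊X ω⌋ = k} := fun k => by
    have := Measure.map_apply_of_aemeasurable hX
      (measurable_floor_mul 1 (measurableSet_singleton k))
    simp only [Nat.cast_one, one_mul] at this
    simp only [gridMass, Measure.real, Nat.cast_one, one_mul]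
    exact congrArg ENNReal.toReal this
  simp_rw [gridEntropy, floorEntropy, h]

theorem lintegral_inversionCoins_le_gridEntropy {Ω : Type*} [MeasurableSpace Ω] {Q : Measure Ω}
    [IsProbabilityMeasure Q] {B : ℕ → Ω → Bool} (hB : IsFairCoins Q B) (μ : Measure ℝ)
    [IsProbabilityMeasure μ] [NullSingletonClass μ] {n : ℕ} (hn : 0 < n) {ε : ℝ}
    (hε : 1 / (n : ℝ) ≤ 2 * ε) :
    ∫⁻ ω, ((inversionCoins (cdf μ) ε (fun j => B j ω) : ℕ∞) : ℝ≥0∞) ∂Q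
      ≤ gridEntropy μ n + 3 := by
  have hn' : (0 : ℝ) < n := by exact_mod_cast hn
  have h := lintegral_inversionCoins_le hB (monotone_cdf μ) (tendsto_cdf_atBot μ)
    (tendsto_cdf_atTop μ) (ε := ε) (c := fun k : ℤ => (k : ℝ) / n)
    ((tendsto_intCast_atBot_iff.mpr tendsto_id).atBot_div_const hn')
    (tendsto_intCast_atTop_atTop.atTop_div_const hn') (fun k => by
      push_cast
      rw [← sub_div, add_sub_cancel_left]
      exact hε)
  refine h.trans (le_of_eq ?_)
  simp_rw [cdf_sub_cdf_eq_gridMass μ hn]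
  have : (3 : ℝ≥0∞) = ∑' k, ENNReal.ofReal (gridMass μ n k * 3) := by
    simp_rw [ENNReal.ofReal_mul (gridMass_nonneg μ n _)]
    rw [ENNReal.tsum_mul_right, tsum_ofReal_gridMass, one_mul, ENNReal.ofReal_ofNat]
  rw [this, gridEntropy, ← ENNReal.tsum_add]
  refine tsum_congr fun k => ?_
  have h0 := gridMass_nonneg μ n k
  rw [← ENNReal.ofReal_add (mul_nonneg h0 (logb_one_div_nonneg h0 (gridMass_le_one _ _ _)))
    (by positivity), mul_add]

/-- The accuracy window has length `2 * ε`, not `ε`; this is where the `-1` that lowers the constant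
from `3` to `2` arises. Rounding up costs the factor `1 + 2 * ε`. -/
lemma logb_ceil_le {ε : ℝ} (hε : 0 < ε) :
    Real.logb 2 ⌈1 / (2 * ε)⌉₊ ≤ Real.logb 2 (1 / ε) - 1 + Real.logb 2 (1 + 2 * ε) := by
  have hpos : (0 : ℝ) < ⌈1 / (2 * ε)⌉₊ := by
    exact_mod_cast Nat.ceil_pos.mpr (by positivity)
  calc Real.logb 2 ⌈1 / (2 * ε)⌉₊ ≤ Real.logb 2 (1 / ε / 2 * (1 + 2 * ε)) := by
        refine Real.logb_le_logb_of_le (by norm_num) hpos ?_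
        refine (Nat.ceil_lt_add_one (by positivity)).le.trans (le_of_eq ?_)
        field_simp
    _ = _ := by
        rw [Real.logb_mul (by positivity) (by positivity), Real.logb_div (by positivity)
          (by norm_num), Real.logb_self_eq_one (by norm_num)]

theorem mainTheorem4
    {Ω : Type*} [MeasurableSpace Ω] (P : Measure Ω) [IsProbabilityMeasure P]
    (X : Ω → ℝ) (hX : AEMeasurable X P)
    (f : ℝ → ℝ) (hf : IsDensityOf P X f)
    (hRenyi : RenyiCondition P X)
    (hEnt : ⊥ < differentialEntropy f)
    {Ω' : Type*} [MeasurableSpace Ω'] (Q : Measure Ω') [IsProbabilityMeasure Q]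
    (B : ℕ → Ω' → Bool) (hB : IsFairCoins Q B) :
    differentialEntropy f < ⊤ ∧
    ∃ r : ℝ → ℝ, Tendsto r (𝓝[>] 0) (𝓝 0) ∧
      ∀ᶠ ε : ℝ in 𝓝[>] 0,
        ((∫⁻ ω, ((inversionCoins (cdf (P.map X)) ε (fun j => B j ω) : ℕ∞) : ℝ≥0∞) ∂Q : ℝ≥0∞)
            : EReal)
          ≤ ((Real.logb 2 (1 / ε) : ℝ) : EReal) + differentialEntropy f + 2 + ((r ε : ℝ) : EReal) := by
  set μ := P.map X with hμ
  have : IsProbabilityMeasure μ := Measure.isProbabilityMeasure_map hX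
  have hdens := hf.map_eq
  rw [← hμ] at hdens
  have : NullSingletonClass μ := by
    rw [hdens]
    infer_instance
  have hH : gridEntropy μ 1 ≠ ∞ := by
    rw [hμ, gridEntropy_map_one P hX]
    exact hRenyi.ne
  -- An infinite negative part would make the difference `⊥` in `EReal`, whatever the positive part.
  have hneg : ∫⁻ x, ENNReal.ofReal (-(f x * Real.logb 2 (1 / f x))) ≠ ∞ := by
    intro h
    rw [differentialEntropy, h] at hEnt
    simp at hEnt
  obtain ⟨hpos, δ, hδ, hle⟩ := exists_gridEntropy_le hf.measurable hf.nonneg hdens hH hneg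
  have hE : differentialEntropy f
      = (((∫⁻ x, ENNReal.ofReal (f x * Real.logb 2 (1 / f x))).toReal
        - (∫⁻ x, ENNReal.ofReal (-(f x * Real.logb 2 (1 / f x)))).toReal : ℝ) : EReal) := by
    rw [differentialEntropy, EReal.coe_sub, EReal.coe_ennreal_toReal hpos,
      EReal.coe_ennreal_toReal hneg]
  rw [hE]
  -- The grid is the coarsest one with `1 / n ≤ 2 * ε`; the remainder adds the error in Rényi's
  -- theorem and the cost of rounding `1 / (2 * ε)` up.
  refine ⟨EReal.coe_lt_top _, fun ε => δ ⌈1 / (2 * ε)⌉₊ + Real.logb 2 (1 + 2 * ε), ?_, ?_⟩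
  · have h1 : Tendsto (fun ε : ℝ => ⌈1 / (2 * ε)⌉₊) (𝓝[>] 0) atTop := by
      refine tendsto_nat_ceil_atTop.comp ?_
      have : (fun ε : ℝ => 1 / (2 * ε)) = fun ε => 2⁻¹ * ε⁻¹ := by
        ext ε
        rw [one_div, mul_inv]
      rw [this]
      exact tendsto_inv_nhdsGT_zero.const_mul_atTop (by norm_num)
    have h2 : Tendsto (fun ε : ℝ => Real.logb 2 (1 + 2 * ε)) (𝓝[>] 0) (𝓝 0) := by
      have hc : ContinuousAt (fun ε : ℝ => Real.logb 2 (1 + 2 * ε)) 0 := by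
        refine ContinuousAt.div_const (ContinuousAt.log (by fun_prop) (by norm_num)) _
      have := hc.tendsto
      simp only [mul_zero, add_zero, Real.logb_one] at this
      exact this.mono_left nhdsWithin_le_nhds
    simpa using (hδ.comp h1).add h2
  · filter_upwards [self_mem_nhdsWithin] with ε hε
    have hε : 0 < ε := hε
    have hn : 0 < ⌈1 / (2 * ε)⌉₊ := Nat.ceil_pos.mpr (by positivity)
    have hmesh : 1 / (⌈1 / (2 * ε)⌉₊ : ℝ) ≤ 2 * ε :=
      (one_div_le (by exact_mod_cast hn) (by positivity)).mpr (Nat.le_ceil _)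
    obtain ⟨hfin, hS⟩ := hle _ hn
    have hT := lintegral_inversionCoins_le_gridEntropy hB μ hn hmesh
    have hlog := logb_ceil_le hε
    refine (EReal.coe_ennreal_le_coe_ennreal_iff.mpr hT).trans ?_
    have h3 : gridEntropy μ ⌈1 / (2 * ε)⌉₊ + 3 ≠ ∞ :=
      ENNReal.add_ne_top.mpr ⟨hfin, by simp⟩
    rw [← EReal.coe_ennreal_toReal h3, ENNReal.toReal_add hfin (by simp), ENNReal.toReal_ofNat]
    rw [show (2 : EReal) = ((2 : ℝ) : EReal) from rfl, ← EReal.coe_add, ← EReal.coe_add,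
      ← EReal.coe_add, EReal.coe_le_coe_iff]
    linarith
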